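/- Let $X_1, X_2, \ldots$ be independent random variables, each uniformly distributed on $[1,e]$. For real $t \ge 0$ let $N(t)$ be the expected number of selections until the product exceeds $e^t$, that is, the expected value of $\min\{n : X_1 X_2 \cdots X_n > e^t\}$ (with $\min\emptyset=\infty$). Then $N(t)$ is finite for every $t \ge 0$, and $$N(t) = (e-1)\left(t + \frac{e-2}{2}\right) + o(1) \qquad (t \to \infty).$$ Equivalently, let $f(x) = \ln(1+(e-1)x)$, an increasing bijection $[0,1]\to[0,1]$, and let $U_1, U_2, \ldots$ be independent random variables, each uniformly distributed on $[0,1]$. Let $N_f(t)$ be the expected value of $\min\{n : f(U_1) + \cdots + f(U_n) > t\}$, let $\mu_f$ be the expected value of $f(U_i)$ (the same for every $i$), and let $$c_f = \frac{1}{\mu_f}\int_0^1 \int_{f^{-1}(u)}^1 (f(x)-u)\,dx\,du.$$ Then $N_f(t) = N(t)$ for all $t \ge 0$, $\mu_f = \frac{1}{e-1}$, $c_f = \frac{e-2}{2}$, and the formula above reads $N_f(t) = \frac{t+c_f}{\mu_f} + o(1)$ as $t\to\infty$. -/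

import Mathlib

open MeasureTheory ProbabilityTheory Set Filter Asymptotics
open scoped ENNReal

noncomputable section

/-- The least number `n` of selections for which the product of the first `n` selected numbers
exceeds `a`; it is `∞` if this never happens. -/
def productDraws {Ω : Type*} (X : ℕ → Ω → ℝ) (a : ℝ) (ω : Ω) : ℕ∞ :=
  ⨅ n ∈ {n : ℕ | a < ∏ i ∈ Finset.range n, X i ω}, (n : ℕ∞)

/-- `N(t)`: the expected number of selections until the product exceeds `e ^ t`,
as an element of `[0, ∞]`. -/
def expectedProductDraws {Ω : Type*} [MeasurableSpace Ω] (P : Measure Ω) (X : ℕ → Ω → ℝ)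
    (t : ℝ) : ℝ≥0∞ :=
  ∫⁻ ω, (productDraws X (Real.exp t) ω : ℝ≥0∞) ∂P

/-- `K_f`: the least number `n` of selections for which `f (U 0) + ⋯ + f (U (n - 1))` exceeds `t`;
it is `∞` if this never happens. -/
def sumDraws {Ω : Type*} (U : ℕ → Ω → ℝ) (f : ℝ → ℝ) (t : ℝ) (ω : Ω) : ℕ∞ :=
  ⨅ n ∈ {n : ℕ | t < ∑ i ∈ Finset.range n, f (U i ω)}, (n : ℕ∞)

/-- `N_f(t)`: the expected value of `K_f`, as an element of `[0, ∞]`. -/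
def expectedSumDraws {Ω : Type*} [MeasurableSpace Ω] (P : Measure Ω) (U : ℕ → Ω → ℝ)
    (f : ℝ → ℝ) (t : ℝ) : ℝ≥0∞ :=
  ∫⁻ ω, (sumDraws U f t ω : ℝ≥0∞) ∂P

/-- `μ_f`: the expected value of `f (U i)`, for identically distributed `U i`
(the index `0` is used). -/
def stepMean {Ω : Type*} [MeasurableSpace Ω] (P : Measure Ω) (U : ℕ → Ω → ℝ)
    (f : ℝ → ℝ) : ℝ :=
  ∫ ω, f (U 0 ω) ∂P

/-- `c_f = (∫_0^1 ∫_{f⁻¹(u)}^1 (f(x) - u) dx du) / μ_f`, where `f⁻¹` is the inverse of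
the bijection `f : [0,1] → [0,1]`. -/
def excessConst {Ω : Type*} [MeasurableSpace Ω] (P : Measure Ω) (U : ℕ → Ω → ℝ)
    (f : ℝ → ℝ) : ℝ :=
  (∫ u in (0 : ℝ)..1, ∫ x in (Function.invFunOn f (Icc 0 1) u)..1, (f x - u)) / stepMean P U f

/-- The function `x ↦ ln (1 + (e - 1) x)`. -/
def logStep (x : ℝ) : ℝ := Real.log (1 + (Real.exp 1 - 1) * x)

end

/-! Both expectations equal the renewal function `R(t) = ∑ P(S_n ≤ t)` of one step law, with density
`p(y) = e^y/(e-1)` on `[0,1]`: the law of `log X` and of `logStep U`. A Chernoff bound makes `R`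
finite.

The renewal equation `R = 1 + p * R` is no contraction, since `p` has mass 1. A second identity
helps: with `q(u) = (e - e^u)/(e-1)` the tail of a step, `q * R = t` for `t ≥ 0`
(`lintegral_tail_mul_renewal`). Subtracting `1/(e-1)` times it from the renewal equation leaves the
kernel `g = p - q/(e-1)`, which is nonnegative and has mass `1 - 1/(e-1)^2 < 1`. The affine function
`(e-1)(t + (e-2)/2)` solves the same reduced equation, so the error satisfies `D = g * D` exactly
for `t ≥ 0` (`logRenewalError_eq_integral`). As `g` lives on `[0,1]`, the bound on `|D|` shrinks by
the mass of `g` on each successive unit interval, so `D` decays geometrically. -/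

/-! ### Expected number of draws as a renewal function -/

/-- The `n`-fold convolution power of a measure on `ℝ`. -/
noncomputable def convPow (ν : Measure ℝ) : ℕ → Measure ℝ
  | 0 => Measure.dirac 0
  | n + 1 => (convPow ν n).conv ν

/-- The renewal function of a step distribution `ν`: the expected number of indices `n` for which
the sum of `n` independent steps is at most `t`. -/
noncomputable def renewal (ν : Measure ℝ) (t : ℝ) : ℝ≥0∞ :=
  ∑' n, convPow ν n (Iic t)

instance sFinite_convPow (ν : Measure ℝ) [SFinite ν] (n : ℕ) : SFinite (convPow ν n) := by
  induction n with
  | zero => rw [convPow]; infer_instance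
  | succ n ih => rw [convPow]; infer_instance

lemma map_sum_range_eq_convPow {Ω : Type*} [MeasurableSpace Ω] {P : Measure Ω}
    [IsProbabilityMeasure P] {Y : ℕ → Ω → ℝ} (hY : ∀ i, Measurable (Y i)) (hind : iIndepFun Y P)
    {ν : Measure ℝ} (hν : ∀ i, P.map (Y i) = ν) (n : ℕ) :
    P.map (fun ω => ∑ i ∈ Finset.range n, Y i ω) = convPow ν n := by
  induction n with
  | zero => simp [convPow]
  | succ n ih =>
    have h := hind.indepFun_sum_range_succ hY n
    have h2 := h.map_add_eq_map_conv_map (by fun_prop) (hY n)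
    rw [convPow, ← ih, ← hν n]
    convert h2 using 2
    · ext ω; simp [Finset.sum_range_succ]
    · congr 1; ext ω; simp

lemma ENat.coe_eq_tsum_lt (K : ℕ∞) :
    (K : ℝ≥0∞) = ∑' n : ℕ, if (n : ℕ∞) < K then (1 : ℝ≥0∞) else 0 := by
  induction K using ENat.recTopCoe with
  | top => simp
  | coe k =>
    rw [tsum_eq_sum (s := Finset.range k) (by simp +contextual)]
    rw [Finset.sum_congr rfl (g := fun _ => (1 : ℝ≥0∞)) (by simp +contextual)]
    simp

/-- Nonnegative steps make the partial sums monotone, so one sum at most `t` forces all earlier ones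
to be at most `t`. The strict `n < K` counts from `n = 0`, the empty sum. -/
lemma lt_sumDraws_iff {Ω : Type*} {U : ℕ → Ω → ℝ} {f : ℝ → ℝ} {t : ℝ} {ω : Ω}
    (h : ∀ i, 0 ≤ f (U i ω)) (n : ℕ) :
    (n : ℕ∞) < sumDraws U f t ω ↔ ∑ i ∈ Finset.range n, f (U i ω) ≤ t := by
  have hmono : Monotone fun n => ∑ i ∈ Finset.range n, f (U i ω) :=
    Finset.sum_mono_set_of_nonneg h |>.comp Finset.range_mono
  constructor
  · intro hn
    by_contra! hlt
    exact absurd (show sumDraws U f t ω ≤ n from iInf₂_le n hlt) (not_le.mpr hn)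
  · intro hn
    have : ((n + 1 : ℕ) : ℕ∞) ≤ sumDraws U f t ω := by
      refine le_iInf₂ fun m hm => ?_
      have hm' : t < ∑ i ∈ Finset.range m, f (U i ω) := hm
      by_contra! hlt
      have : m ≤ n := by
        have : m < n + 1 := by exact_mod_cast hlt
        omega
      exact absurd (hmono this) (not_le.mpr (hn.trans_lt hm'))
    exact lt_of_lt_of_le (by exact_mod_cast n.lt_succ_self) this

lemma expectedSumDraws_eq_renewal {Ω : Type*} [MeasurableSpace Ω] {P : Measure Ω}
    [IsProbabilityMeasure P] {U : ℕ → Ω → ℝ} (hU : ∀ i, Measurable (U i)) (hind : iIndepFun U P)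
    {f : ℝ → ℝ} (hf : Measurable f) (hpos : ∀ i, ∀ᵐ ω ∂P, 0 ≤ f (U i ω))
    {ν : Measure ℝ} (hν : ∀ i, P.map (fun ω => f (U i ω)) = ν) (t : ℝ) :
    expectedSumDraws P U f t = renewal ν t := by
  have hm : ∀ i, Measurable fun ω => f (U i ω) := fun i => hf.comp (hU i)
  have hS : ∀ n, Measurable fun ω => ∑ i ∈ Finset.range n, f (U i ω) := fun n =>
    Finset.measurable_fun_sum _ fun i _ => hm i
  have hind' : iIndepFun (fun i ω => f (U i ω)) P := hind.comp (fun _ => f) fun _ => hf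
  calc expectedSumDraws P U f t
      = ∫⁻ ω, ∑' n : ℕ, {ω | ∑ i ∈ Finset.range n, f (U i ω) ≤ t}.indicator 1 ω ∂P := by
        refine lintegral_congr_ae ?_
        filter_upwards [ae_all_iff.mpr hpos] with ω hω
        rw [ENat.coe_eq_tsum_lt]
        refine tsum_congr fun n => ?_
        simp only [lt_sumDraws_iff hω, indicator, mem_ofPred_eq, Pi.one_apply]
    _ = ∑' n : ℕ, P {ω | ∑ i ∈ Finset.range n, f (U i ω) ≤ t} := by
        rw [lintegral_tsum fun n =>
          (measurable_one.indicator (measurableSet_le (hS n) measurable_const)).aemeasurable]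
        exact tsum_congr fun n =>
          lintegral_indicator_one (measurableSet_le (hS n) measurable_const)
    _ = renewal ν t := by
        refine tsum_congr fun n => ?_
        rw [← map_sum_range_eq_convPow hm hind' hν n, Measure.map_apply (hS n) measurableSet_Iic]
        rfl

lemma expectedProductDraws_eq_expectedSumDraws {Ω : Type*} [MeasurableSpace Ω] {P : Measure Ω}
    {X : ℕ → Ω → ℝ} (hX : ∀ i, ∀ᵐ ω ∂P, 0 < X i ω) (t : ℝ) :
    expectedProductDraws P X t = expectedSumDraws P X Real.log t := by
  refine lintegral_congr_ae ?_
  filter_upwards [ae_all_iff.mpr hX] with ω hω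
  have : ∀ n, Real.exp t < ∏ i ∈ Finset.range n, X i ω ↔
      t < ∑ i ∈ Finset.range n, Real.log (X i ω) := fun n => by
    rw [← Real.log_prod fun i _ => (hω i).ne',
      Real.lt_log_iff_exp_lt (Finset.prod_pos fun i _ => hω i)]
  simp only [productDraws, sumDraws, this]

/-! ### The common step law of the two models -/

lemma exp_one_sub_one_pos : 0 < Real.exp 1 - 1 := by
  have := Real.add_one_lt_exp (one_ne_zero)
  linarith

/-- The distribution of the logarithm of a uniform number from `[1, e]`. -/
noncomputable def logUniform : Measure ℝ :=
  (volume.restrict (Icc 0 1)).withDensity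
    fun y => ENNReal.ofReal (Real.exp y / (Real.exp 1 - 1))

lemma lintegral_logUniform {h : ℝ → ℝ≥0∞} (hh : Measurable h) :
    ∫⁻ y, h y ∂logUniform
      = ∫⁻ y in Icc 0 1, ENNReal.ofReal (Real.exp y / (Real.exp 1 - 1)) * h y := by
  rw [logUniform, lintegral_withDensity_eq_lintegral_mul _ (by fun_prop) hh]
  rfl

/-- Change of variables through the inverse `k` of `f`: `hk'` says that `|k'|`, divided by the
length of the image of `k`, is the density of `logUniform`. It serves both models, with `k = exp`
and `k = expStep`. -/
lemma map_eq_logUniform {Ω : Type*} [MeasurableSpace Ω] {P : Measure Ω} {V : Ω → ℝ}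
    (hV : Measurable V) {k k' f : ℝ → ℝ} (hVs : pdf.IsUniform V (k '' Icc 0 1) P volume)
    (hvol : volume (k '' Icc 0 1) ≠ 0) (hvol' : volume (k '' Icc 0 1) ≠ ∞)
    (hk : ∀ y, HasDerivAt k (k' y) y) (hf : Measurable f) (hfk : ∀ y ∈ Icc (0 : ℝ) 1, f (k y) = y)
    (hk' : ∀ y ∈ Icc (0 : ℝ) 1, ENNReal.ofReal |k' y|
      = volume (k '' Icc 0 1) * ENNReal.ofReal (Real.exp y / (Real.exp 1 - 1))) :
    P.map (fun ω => f (V ω)) = logUniform := by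
  ext A hA
  have hinj : InjOn k (Icc 0 1) := fun x hx y hy hxy => by rw [← hfk x hx, hxy, hfk y hy]
  have hmA : Measurable (A.indicator (1 : ℝ → ℝ≥0∞)) := measurable_one.indicator hA
  rw [← lintegral_indicator_one hA, ← lintegral_indicator_one hA, lintegral_logUniform hmA,
    lintegral_map hmA (show Measurable fun ω => f (V ω) from hf.comp hV),
    ← lintegral_map (f := fun x => A.indicator (1 : ℝ → ℝ≥0∞) (f x)) (hmA.comp hf) hV,
    show P.map V = _ from hVs,
    ProbabilityTheory.cond, lintegral_smul_measure,
    lintegral_image_eq_lintegral_abs_deriv_mul measurableSet_Icc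
      (fun x _ => (hk x).hasDerivWithinAt) hinj]
  rw [smul_eq_mul, ← lintegral_const_mul' _ _ (ENNReal.inv_ne_top.mpr hvol)]
  refine setLIntegral_congr_fun measurableSet_Icc fun y hy => ?_
  simp only [hk' y hy, hfk y hy]
  rw [← mul_assoc, ← mul_assoc, ENNReal.inv_mul_cancel hvol hvol', one_mul]

lemma image_exp_Icc : Real.exp '' Icc 0 1 = Icc 1 (Real.exp 1) := by
  ext x
  constructor
  · rintro ⟨y, hy, rfl⟩
    exact ⟨Real.one_le_exp hy.1, Real.exp_le_exp.mpr hy.2⟩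
  · intro hx
    have h0 : 0 < x := by linarith [hx.1]
    exact ⟨Real.log x, ⟨Real.log_nonneg hx.1, (Real.log_le_iff_le_exp h0).mpr hx.2⟩,
      Real.exp_log h0⟩

lemma map_log_eq_logUniform {Ω : Type*} [MeasurableSpace Ω] {P : Measure Ω} {V : Ω → ℝ}
    (hV : Measurable V) (hVs : pdf.IsUniform V (Icc 1 (Real.exp 1)) P volume) :
    P.map (fun ω => Real.log (V ω)) = logUniform := by
  have he := exp_one_sub_one_pos
  have hvol : volume (Icc 1 (Real.exp 1)) = ENNReal.ofReal (Real.exp 1 - 1) := Real.volume_Icc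
  refine map_eq_logUniform (k := Real.exp) (k' := Real.exp) hV ?_ ?_ ?_ Real.hasDerivAt_exp
    Real.measurable_log (fun y _ => Real.log_exp y) ?_
  all_goals rw [image_exp_Icc]
  · exact hVs
  · simp [hvol]
  · simp [hvol]
  · intro y _
    rw [hvol, ← ENNReal.ofReal_mul he.le, mul_div_cancel₀ _ he.ne', abs_of_pos (Real.exp_pos y)]

/-- The inverse `y ↦ (e ^ y - 1) / (e - 1)` of `logStep`. -/
noncomputable def expStep (y : ℝ) : ℝ := (Real.exp y - 1) / (Real.exp 1 - 1)

lemma logStep_expStep (y : ℝ) : logStep (expStep y) = y := by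
  have he := exp_one_sub_one_pos
  rw [logStep, expStep, mul_div_cancel₀ _ he.ne', add_sub_cancel, Real.log_exp]

lemma expStep_mem {y : ℝ} (hy : y ∈ Icc (0 : ℝ) 1) : expStep y ∈ Icc (0 : ℝ) 1 := by
  have he := exp_one_sub_one_pos
  refine ⟨div_nonneg (by linarith [Real.one_le_exp hy.1]) he.le, (div_le_one he).mpr ?_⟩
  linarith [Real.exp_le_exp.mpr hy.2]

lemma expStep_logStep {x : ℝ} (hx : 0 ≤ x) : expStep (logStep x) = x := by
  have he := exp_one_sub_one_pos
  rw [logStep, expStep, Real.exp_log (by positivity), add_sub_cancel_left,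
    mul_div_cancel_left₀ _ he.ne']

lemma logStep_mem {x : ℝ} (hx : x ∈ Icc (0 : ℝ) 1) : logStep x ∈ Icc (0 : ℝ) 1 := by
  have he := exp_one_sub_one_pos
  have h0 : 0 ≤ (Real.exp 1 - 1) * x := mul_nonneg he.le hx.1
  refine ⟨Real.log_nonneg (by linarith), (Real.log_le_iff_le_exp (by linarith)).mpr ?_⟩
  nlinarith [hx.2]

lemma strictMonoOn_logStep : StrictMonoOn logStep (Icc 0 1) := fun x hx y _ hxy => by
  have he := exp_one_sub_one_pos
  have h0 : 0 ≤ (Real.exp 1 - 1) * x := mul_nonneg he.le hx.1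
  exact Real.log_lt_log (by linarith) (by nlinarith)

lemma bijOn_logStep : BijOn logStep (Icc 0 1) (Icc 0 1) :=
  ⟨fun _ hx => logStep_mem hx, strictMonoOn_logStep.injOn,
    fun y hy => ⟨expStep y, expStep_mem hy, logStep_expStep y⟩⟩

lemma image_expStep_Icc : expStep '' Icc 0 1 = Icc 0 1 := by
  ext x
  constructor
  · rintro ⟨y, hy, rfl⟩
    exact expStep_mem hy
  · exact fun hx => ⟨logStep x, logStep_mem hx, expStep_logStep hx.1⟩

lemma measurable_logStep : Measurable logStep :=
  Real.measurable_log.comp (by fun_prop)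

lemma map_logStep_eq_logUniform {Ω : Type*} [MeasurableSpace Ω] {P : Measure Ω} {V : Ω → ℝ}
    (hV : Measurable V) (hVs : pdf.IsUniform V (Icc 0 1) P volume) :
    P.map (fun ω => logStep (V ω)) = logUniform := by
  have he := exp_one_sub_one_pos
  refine map_eq_logUniform (k := expStep) (k' := fun y => Real.exp y / (Real.exp 1 - 1)) hV
    ?_ ?_ ?_ (fun y => ((Real.hasDerivAt_exp y).sub_const 1).div_const _)
    measurable_logStep (fun y _ => logStep_expStep y) ?_
  all_goals rw [image_expStep_Icc]
  · exact hVs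
  · simp
  · simp
  · intro y _
    rw [Real.volume_Icc, sub_zero, ENNReal.ofReal_one, one_mul,
      abs_of_pos (div_pos (Real.exp_pos y) he)]

lemma ae_mem_of_isUniform {Ω : Type*} [MeasurableSpace Ω] {P : Measure Ω} {V : Ω → ℝ}
    (hV : Measurable V) {s : Set ℝ} (hs : MeasurableSet s)
    (hVs : pdf.IsUniform V s P volume) : ∀ᵐ ω ∂P, V ω ∈ s := by
  refine ae_of_ae_map hV.aemeasurable ?_
  rw [hVs]
  exact ae_cond_mem hs

/-! ### Renewal equation and finiteness -/

lemma monotone_renewal (ν : Measure ℝ) : Monotone (renewal ν) := fun _ _ hst =>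
  ENNReal.tsum_le_tsum fun _ => measure_mono (Iic_subset_Iic.mpr hst)

lemma convPow_succ_Iic (ν : Measure ℝ) [SFinite ν] (n : ℕ) (t : ℝ) :
    convPow ν (n + 1) (Iic t) = ∫⁻ y, convPow ν n (Iic (t - y)) ∂ν := by
  rw [convPow, Measure.conv_comm, ← lintegral_indicator_one measurableSet_Iic,
    Measure.lintegral_conv (measurable_one.indicator measurableSet_Iic)]
  refine lintegral_congr fun y => ?_
  rw [← lintegral_indicator_one measurableSet_Iic]
  refine lintegral_congr fun x => ?_
  simp only [indicator, mem_Iic, le_sub_iff_add_le', Pi.one_apply]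

/-- Condition on one step in every term with `n ≥ 1`. The term `n = 0` is the point mass at `0`,
which contributes `1` because `0 ≤ t`. -/
lemma renewal_eq_add_lintegral (ν : Measure ℝ) [SFinite ν] {t : ℝ} (ht : 0 ≤ t) :
    renewal ν t = 1 + ∫⁻ y, renewal ν (t - y) ∂ν := by
  have hm : ∀ n, Measurable fun y => convPow ν n (Iic (t - y)) := fun n =>
    Antitone.measurable fun _ _ h => measure_mono (Iic_subset_Iic.mpr (by linarith))
  simp only [renewal]
  rw [tsum_eq_zero_add' ENNReal.summable, lintegral_tsum fun n => (hm n).aemeasurable]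
  simp only [convPow_succ_Iic]
  simp [convPow, ht]

instance isProbabilityMeasure_logUniform : IsProbabilityMeasure logUniform := by
  have he := exp_one_sub_one_pos
  constructor
  rw [← lintegral_one, lintegral_logUniform measurable_const]
  simp only [mul_one]
  rw [← ofReal_integral_eq_lintegral_ofReal, integral_Icc_eq_integral_Ioc,
    ← intervalIntegral.integral_of_le zero_le_one, intervalIntegral.integral_div, integral_exp,
    Real.exp_zero, div_self he.ne', ENNReal.ofReal_one]
  · exact (Continuous.integrableOn_Icc (by fun_prop))
  · exact Eventually.of_forall fun y => by positivity

/-- The weight `e^(-y)` cancels the density `e^y/(e-1)`, so one step has Laplace transform `1/(e-1)`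
at `1`; sums of steps multiply it. As `e > 2`, this is a geometric sequence tending to `0`. -/
lemma lintegral_exp_neg_convPow (n : ℕ) :
    ∫⁻ x, ENNReal.ofReal (Real.exp (-x)) ∂convPow logUniform n
      = ENNReal.ofReal (1 / (Real.exp 1 - 1)) ^ n := by
  have he := exp_one_sub_one_pos
  induction n with
  | zero => simp [convPow]
  | succ n ih =>
    have h1 : ∫⁻ y, ENNReal.ofReal (Real.exp (-y)) ∂logUniform
        = ENNReal.ofReal (1 / (Real.exp 1 - 1)) := by
      rw [lintegral_logUniform (by fun_prop)]
      have : ∀ y : ℝ, ENNReal.ofReal (Real.exp y / (Real.exp 1 - 1))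
          * ENNReal.ofReal (Real.exp (-y)) = ENNReal.ofReal (1 / (Real.exp 1 - 1)) := fun y => by
        rw [← ENNReal.ofReal_mul (by positivity), div_mul_eq_mul_div, ← Real.exp_add, add_neg_cancel,
          Real.exp_zero]
      simp [this]
    rw [convPow, Measure.lintegral_conv (by fun_prop)]
    simp only [neg_add, Real.exp_add, ENNReal.ofReal_mul (Real.exp_pos _).le]
    simp_rw [lintegral_const_mul' _ _ ENNReal.ofReal_ne_top, h1]
    rw [lintegral_mul_const' _ _ ENNReal.ofReal_ne_top, ih, pow_succ]

lemma ofReal_one_div_lt_one : ENNReal.ofReal (1 / (Real.exp 1 - 1)) < 1 := by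
  have h := Real.add_one_lt_exp (one_ne_zero)
  rw [ENNReal.ofReal_lt_one, div_lt_one exp_one_sub_one_pos]
  linarith

lemma lintegral_exp_sub_convPow (t : ℝ) (n : ℕ) :
    ∫⁻ x, ENNReal.ofReal (Real.exp (t - x)) ∂convPow logUniform n
      = ENNReal.ofReal (Real.exp t) * ENNReal.ofReal (1 / (Real.exp 1 - 1)) ^ n := by
  rw [← lintegral_exp_neg_convPow, ← lintegral_const_mul' _ _ ENNReal.ofReal_ne_top]
  refine lintegral_congr fun x => ?_
  rw [← ENNReal.ofReal_mul (Real.exp_pos t).le, ← Real.exp_add, sub_eq_add_neg]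

lemma renewal_logUniform_ne_top (t : ℝ) : renewal logUniform t ≠ ∞ := by
  have hle : renewal logUniform t
      ≤ ∑' n, ENNReal.ofReal (Real.exp t) * ENNReal.ofReal (1 / (Real.exp 1 - 1)) ^ n := by
    -- Chernoff bound: the indicator of `x ≤ t` is at most `e^(t-x)`.
    refine ENNReal.tsum_le_tsum fun n => ?_
    rw [← lintegral_exp_sub_convPow, ← lintegral_indicator_one measurableSet_Iic]
    refine lintegral_mono (indicator_le fun x hx => ?_)
    rw [Pi.one_apply, ENNReal.one_le_ofReal]
    exact Real.one_le_exp (sub_nonneg.mpr hx)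
  refine ne_top_of_le_ne_top ?_ hle
  rw [ENNReal.tsum_mul_left, ENNReal.tsum_geometric]
  exact ENNReal.mul_ne_top ENNReal.ofReal_ne_top
    (ENNReal.inv_ne_top.mpr (tsub_pos_of_lt ofReal_one_div_lt_one).ne')

/-! ### The tail identity -/

/-- The upper tail `(e - e ^ u) / (e - 1)` of `logUniform`, integrated over `[0, s]`. -/
noncomputable def tailIntegral (s : ℝ) : ℝ≥0∞ :=
  ∫⁻ u in Icc 0 1,
    ENNReal.ofReal ((Real.exp 1 - Real.exp u) / (Real.exp 1 - 1)) * (Iic s).indicator 1 u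

/-- With `Y` a step, `s⁺ - (s - Y)⁺ = min(s⁺, Y)`, whose expectation is the integral of the tail of
`Y` up to `s`. -/
lemma ofReal_eq_lintegral_add_tailIntegral (s : ℝ) :
    ENNReal.ofReal s = ∫⁻ y, ENNReal.ofReal (s - y) ∂logUniform + tailIntegral s := by
  have he := exp_one_sub_one_pos
  rw [lintegral_logUniform (by fun_prop), tailIntegral, ← lintegral_add_left (by fun_prop)]
  have hpt : ∀ y ∈ Icc (0 : ℝ) 1,
      ENNReal.ofReal (Real.exp y / (Real.exp 1 - 1)) * ENNReal.ofReal (s - y)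
        + ENNReal.ofReal ((Real.exp 1 - Real.exp y) / (Real.exp 1 - 1)) * (Iic s).indicator 1 y
      = (Iic s).indicator (fun y => ENNReal.ofReal
        ((-Real.exp y + (s - y) * Real.exp y + Real.exp 1) / (Real.exp 1 - 1))) y := by
    intro y hy
    have h1 := Real.exp_le_exp.mpr hy.2
    by_cases hys : y ≤ s
    · simp only [indicator, mem_Iic, hys, if_true, Pi.one_apply, mul_one]
      rw [← ENNReal.ofReal_mul (by positivity), ← ENNReal.ofReal_add
        (mul_nonneg (by positivity) (by linarith)) (div_nonneg (by linarith) he.le)]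
      congr 1
      ring
    · simp only [indicator, mem_Iic, hys, if_false, mul_zero, add_zero]
      rw [ENNReal.ofReal_of_nonpos (by linarith : s - y ≤ 0), mul_zero]
  rw [setLIntegral_congr_fun measurableSet_Icc hpt, setLIntegral_indicator measurableSet_Iic]
  have hset : Iic s ∩ Icc 0 1 = Icc 0 (min s 1) := by
    ext y; simp only [mem_inter_iff, mem_Iic, mem_Icc, le_min_iff]; tauto
  rw [hset]
  rcases lt_or_ge s 0 with hs | hs
  · rw [Icc_eq_empty (by simp [hs]), ENNReal.ofReal_of_nonpos hs.le]
    simp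
  have hm : 0 ≤ min s 1 := le_min hs zero_le_one
  rw [← ofReal_integral_eq_lintegral_ofReal (Continuous.integrableOn_Icc (by fun_prop)),
    integral_Icc_eq_integral_Ioc, ← intervalIntegral.integral_of_le hm,
    intervalIntegral.integral_eq_sub_of_hasDerivAt
      (f := fun y => ((s - y) * Real.exp y + Real.exp 1 * y) / (Real.exp 1 - 1))]
  · congr 1
    rw [← sub_div, eq_div_iff he.ne']
    rcases le_total s 1 with h | h
    · rw [min_eq_left h]; simp; ring
    · rw [min_eq_right h]; simp; ring
  · intro y _
    refine (((((hasDerivAt_id y).const_sub s).mul (Real.hasDerivAt_exp y)).add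
      ((hasDerivAt_id y).const_mul (Real.exp 1))).div_const (Real.exp 1 - 1)).congr_deriv ?_
    simp only [id]
    ring
  · exact Continuous.intervalIntegrable (by fun_prop) _ _
  · filter_upwards [ae_restrict_mem measurableSet_Icc] with y hy
    have h1 := Real.exp_le_exp.mpr (hy.2.trans (min_le_right s 1))
    have h2 : 0 ≤ (s - y) * Real.exp y :=
      mul_nonneg (sub_nonneg.mpr (hy.2.trans (min_le_left s 1))) (Real.exp_pos y).le
    exact div_nonneg (by linarith) he.le

lemma monotone_tailIntegral : Monotone tailIntegral := fun _ _ hst =>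
  lintegral_mono fun _ => mul_le_mul_right
    (indicator_le_indicator_of_subset (Iic_subset_Iic.mpr hst) (fun _ => zero_le) _) _

/-- Iterates the one-step decomposition at `s = t - S_n`; the sum telescopes with remainder `E (t -
S_k)⁺`. -/
lemma ofReal_eq_sum_add_lintegral (t : ℝ) (k : ℕ) :
    ENNReal.ofReal t = ∑ n ∈ Finset.range k, ∫⁻ x, tailIntegral (t - x) ∂convPow logUniform n
      + ∫⁻ x, ENNReal.ofReal (t - x) ∂convPow logUniform k := by
  induction k with
  | zero => simp [convPow]
  | succ k ih =>
    have hm : Measurable fun x => tailIntegral (t - x) :=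
      monotone_tailIntegral.measurable.comp (by fun_prop)
    rw [ih, Finset.sum_range_succ, add_assoc, convPow, Measure.lintegral_conv (by fun_prop),
      ← lintegral_add_left hm]
    congr 1
    refine lintegral_congr fun x => ?_
    rw [ofReal_eq_lintegral_add_tailIntegral (t - x), add_comm]
    simp only [sub_sub]

lemma tsum_lintegral_tailIntegral (t : ℝ) :
    ∑' n, ∫⁻ x, tailIntegral (t - x) ∂convPow logUniform n = ENNReal.ofReal t := by
  have hz : Tendsto (fun k => ∫⁻ x, ENNReal.ofReal (t - x) ∂convPow logUniform k) atTop
      (nhds 0) := by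
    have h0 := ENNReal.Tendsto.const_mul (a := ENNReal.ofReal (Real.exp t))
      (ENNReal.tendsto_pow_atTop_nhds_zero_of_lt_one ofReal_one_div_lt_one)
      (Or.inr ENNReal.ofReal_ne_top)
    rw [mul_zero] at h0
    refine tendsto_of_tendsto_of_tendsto_of_le_of_le tendsto_const_nhds h0 (fun _ => zero_le)
      fun k => ?_
    rw [← lintegral_exp_sub_convPow]
    refine lintegral_mono fun x => ENNReal.ofReal_le_ofReal ?_
    -- `t - x ≤ e^(t-x)` bounds the remainder by a null geometric sequence.
    linarith [Real.add_one_le_exp (t - x)]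
  have h := (ENNReal.summable (f := fun n =>
    ∫⁻ x, tailIntegral (t - x) ∂convPow logUniform n)).hasSum.tendsto_sum_nat.add hz
  simp only [← ofReal_eq_sum_add_lintegral, add_zero] at h
  exact tendsto_nhds_unique h tendsto_const_nhds

/-- Tonelli turns each term `E tailIntegral(t - S_n)` into the tail integrated against `P(S_n ≤ t -
u)`; summing over `n` rebuilds the renewal function. -/
lemma lintegral_tail_mul_renewal (t : ℝ) :
    ∫⁻ u in Icc 0 1, ENNReal.ofReal ((Real.exp 1 - Real.exp u) / (Real.exp 1 - 1))
      * renewal logUniform (t - u) = ENNReal.ofReal t := by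
  have hm : ∀ n, Measurable fun u => convPow logUniform n (Iic (t - u)) := fun n =>
    Antitone.measurable fun _ _ h => measure_mono (Iic_subset_Iic.mpr (by linarith))
  simp only [renewal, ← ENNReal.tsum_mul_left]
  rw [lintegral_tsum fun n => by fun_prop, ← tsum_lintegral_tailIntegral t]
  refine tsum_congr fun n => ?_
  have hset : MeasurableSet {p : ℝ × ℝ | p.2 ≤ t - p.1} :=
    measurableSet_le (by fun_prop) (by fun_prop)
  have hind : Measurable fun p : ℝ × ℝ => (Iic (t - p.1)).indicator (1 : ℝ → ℝ≥0∞) p.2 :=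
    (measurable_one (α := ℝ≥0∞)).indicator hset
  simp only [tailIntegral]
  rw [lintegral_lintegral_swap]
  · refine lintegral_congr fun u => ?_
    rw [lintegral_const_mul' _ _ ENNReal.ofReal_ne_top, ← lintegral_indicator_one measurableSet_Iic]
    congr 1
    refine lintegral_congr fun x => ?_
    simp only [indicator, mem_Iic, le_sub_comm, Pi.one_apply]
  · exact ((by fun_prop : Measurable fun p : ℝ × ℝ => ENNReal.ofReal
      ((Real.exp 1 - Real.exp p.2) / (Real.exp 1 - 1))).mul hind).aemeasurable

/-! ### Contraction of the error -/

/-- The renewal function of `logUniform` as a real function. -/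
noncomputable def logRenewal (t : ℝ) : ℝ := (renewal logUniform t).toReal

lemma monotone_logRenewal : Monotone logRenewal := fun _ t hst =>
  ENNReal.toReal_mono (renewal_logUniform_ne_top t) (monotone_renewal _ hst)

lemma logRenewal_nonneg (t : ℝ) : 0 ≤ logRenewal t := ENNReal.toReal_nonneg

lemma intervalIntegrable_logRenewal_mul {h : ℝ → ℝ} (hh : Continuous h) (t a b : ℝ) :
    IntervalIntegrable (fun y => logRenewal (t - y) * h y) volume a b :=
  (Antitone.intervalIntegrable fun _ _ hxy =>
    monotone_logRenewal (by linarith)).mul_continuousOn hh.continuousOn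

lemma toReal_lintegral_renewal {h : ℝ → ℝ} (hh : Continuous h)
    (hpos : ∀ y ∈ Icc (0 : ℝ) 1, 0 ≤ h y) (t : ℝ) :
    (∫⁻ y in Icc 0 1, ENNReal.ofReal (h y) * renewal logUniform (t - y)).toReal
      = ∫ y in (0 : ℝ)..1, logRenewal (t - y) * h y := by
  have hm : Measurable fun y => renewal logUniform (t - y) :=
    (monotone_renewal _).measurable.comp (by fun_prop)
  rw [intervalIntegral.integral_of_le zero_le_one, ← integral_Icc_eq_integral_Ioc,
    ← integral_toReal (f := fun y => ENNReal.ofReal (h y) * renewal logUniform (t - y))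
      (hh.measurable.ennreal_ofReal.mul hm).aemeasurable (Eventually.of_forall fun y =>
        ENNReal.mul_lt_top ENNReal.ofReal_lt_top (renewal_logUniform_ne_top _).lt_top)]
  refine setIntegral_congr_fun measurableSet_Icc fun y hy => ?_
  simp only [ENNReal.toReal_mul, ENNReal.toReal_ofReal (hpos y hy), logRenewal, mul_comm]

lemma logRenewal_eq_one_add {t : ℝ} (ht : 0 ≤ t) :
    logRenewal t
      = 1 + ∫ y in (0 : ℝ)..1, logRenewal (t - y) * (Real.exp y / (Real.exp 1 - 1)) := by
  have he := exp_one_sub_one_pos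
  have h := renewal_eq_add_lintegral logUniform ht
  have hm : Measurable fun y => renewal logUniform (t - y) :=
    (monotone_renewal _).measurable.comp (by fun_prop)
  have hfin : ∫⁻ y, renewal logUniform (t - y) ∂logUniform ≠ ∞ := fun h' =>
    renewal_logUniform_ne_top t (by rw [h, h', add_top])
  rw [logRenewal, h, ENNReal.toReal_add ENNReal.one_ne_top hfin, ENNReal.toReal_one,
    lintegral_logUniform hm,
    toReal_lintegral_renewal (by fun_prop) fun y _ => by positivity]

lemma integral_logRenewal_mul_tail {t : ℝ} (ht : 0 ≤ t) :
    ∫ u in (0 : ℝ)..1, logRenewal (t - u) * ((Real.exp 1 - Real.exp u) / (Real.exp 1 - 1)) = t := by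
  have he := exp_one_sub_one_pos
  rw [← toReal_lintegral_renewal (by fun_prop) fun y hy => div_nonneg
    (sub_nonneg.mpr (Real.exp_le_exp.mpr hy.2)) he.le, lintegral_tail_mul_renewal,
    ENNReal.toReal_ofReal ht]

/-- The difference between `logRenewal` and its asymptote. -/
noncomputable def logRenewalError (t : ℝ) : ℝ :=
  logRenewal t - (Real.exp 1 - 1) * (t + (Real.exp 1 - 2) / 2)

/-- The density of `logUniform` minus its upper tail divided by `e - 1`. -/
noncomputable def reducedKernel (y : ℝ) : ℝ :=
  Real.exp 1 * (Real.exp y - 1) / (Real.exp 1 - 1) ^ 2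

lemma continuous_reducedKernel : Continuous reducedKernel := by
  unfold reducedKernel; fun_prop

lemma reducedKernel_nonneg {y : ℝ} (hy : 0 ≤ y) : 0 ≤ reducedKernel y := by
  have := Real.one_le_exp hy
  have := Real.exp_pos 1
  unfold reducedKernel
  exact div_nonneg (mul_nonneg this.le (by linarith)) (sq_nonneg _)

/-- Serves twice: for the mass of the kernel, and for the asymptote at `t - y`, which is affine in
`y`. -/
lemma integral_affine_mul_reducedKernel (a b : ℝ) :
    ∫ y in (0 : ℝ)..1, (a + b * y) * reducedKernel y
      = (a * (Real.exp 1 - 2) + b / 2) * Real.exp 1 / (Real.exp 1 - 1) ^ 2 := by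
  have he := exp_one_sub_one_pos
  rw [intervalIntegral.integral_eq_sub_of_hasDerivAt
    (f := fun y => ((a - b + b * y) * Real.exp y - a * y - b * (y * y) / 2)
      * (Real.exp 1 / (Real.exp 1 - 1) ^ 2))]
  · simp only [Real.exp_zero]
    ring
  · intro y _
    have h := ((((((hasDerivAt_id y).const_mul b).const_add (a - b)).mul
      (Real.hasDerivAt_exp y)).sub ((hasDerivAt_id y).const_mul a)).sub
      ((((hasDerivAt_id y).mul (hasDerivAt_id y)).const_mul b).div_const 2)).mul_const
      (Real.exp 1 / (Real.exp 1 - 1) ^ 2)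
    refine h.congr_deriv ?_
    simp only [id, reducedKernel]
    ring
  · have := continuous_reducedKernel
    exact Continuous.intervalIntegrable (by fun_prop) _ _

lemma integral_reducedKernel_nonneg : 0 ≤ ∫ y in (0 : ℝ)..1, reducedKernel y :=
  intervalIntegral.integral_nonneg zero_le_one fun _ hy => reducedKernel_nonneg hy.1

lemma integral_reducedKernel_lt_one : ∫ y in (0 : ℝ)..1, reducedKernel y < 1 := by
  have he := exp_one_sub_one_pos
  have h := integral_affine_mul_reducedKernel 1 0
  simp only [zero_mul, add_zero, one_mul, zero_div] at h
  rw [h, div_lt_one (by positivity)]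
  -- The claim is `e(e-2) < (e-1)^2`, whose sides differ by `1`.
  nlinarith

/-- The renewal equation minus `1/(e-1)` times the tail identity, with the asymptote subtracted. The
constant `(e-2)/2` makes the inhomogeneous terms `1 + t/(e-1)` cancel. -/
lemma logRenewalError_eq_integral {t : ℝ} (ht : 0 ≤ t) :
    logRenewalError t = ∫ y in (0 : ℝ)..1, logRenewalError (t - y) * reducedKernel y := by
  have he := exp_one_sub_one_pos
  have hker : ∀ y, reducedKernel y = Real.exp y / (Real.exp 1 - 1)
      - (Real.exp 1 - Real.exp y) / (Real.exp 1 - 1) * (1 / (Real.exp 1 - 1)) := fun y => by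
    rw [reducedKernel]; field_simp; ring
  have h1 : ∫ y in (0 : ℝ)..1, logRenewal (t - y) * reducedKernel y
      = logRenewal t - 1 - t * (1 / (Real.exp 1 - 1)) := by
    simp only [hker, mul_sub]
    simp only [← mul_assoc]
    rw [intervalIntegral.integral_sub
      (intervalIntegrable_logRenewal_mul (by fun_prop) _ _ _)
      ((intervalIntegrable_logRenewal_mul (by fun_prop) _ _ _).mul_const _),
      intervalIntegral.integral_mul_const, integral_logRenewal_mul_tail ht,
      logRenewal_eq_one_add ht]
    ring
  have h2 := integral_affine_mul_reducedKernel
    ((Real.exp 1 - 1) * (t + (Real.exp 1 - 2) / 2)) (-(Real.exp 1 - 1))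
  have hsplit : ∀ y, logRenewalError (t - y) * reducedKernel y
      = logRenewal (t - y) * reducedKernel y
        - ((Real.exp 1 - 1) * (t + (Real.exp 1 - 2) / 2) + -(Real.exp 1 - 1) * y)
          * reducedKernel y := fun y => by
    rw [logRenewalError]; ring
  have hc := continuous_reducedKernel
  simp only [hsplit]
  rw [intervalIntegral.integral_sub (intervalIntegrable_logRenewal_mul hc _ _ _)
    (Continuous.intervalIntegrable (by fun_prop) _ _), h1, h2, logRenewalError]
  field_simp
  ring

lemma abs_logRenewalError_le {t : ℝ} (ht : 0 ≤ t) {B : ℝ}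
    (hB : ∀ s ∈ Icc (t - 1) t, |logRenewalError s| ≤ B) :
    |logRenewalError t| ≤ B * ∫ y in (0 : ℝ)..1, reducedKernel y := by
  rw [logRenewalError_eq_integral ht, ← Real.norm_eq_abs, ← intervalIntegral.integral_const_mul]
  refine intervalIntegral.norm_integral_le_of_norm_le zero_le_one ?_
    ((continuous_reducedKernel.const_mul B).intervalIntegrable _ _)
  refine Eventually.of_forall fun y hy => ?_
  rw [norm_mul, Real.norm_eq_abs, Real.norm_eq_abs, abs_of_nonneg (reducedKernel_nonneg hy.1.le)]
  exact mul_le_mul_of_nonneg_right (hB _ ⟨by linarith [hy.2], by linarith [hy.1]⟩)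
    (reducedKernel_nonneg hy.1.le)

/-- Monotonicity of the renewal function gives local boundedness without any continuity. -/
lemma exists_abs_logRenewalError_le (a b : ℝ) :
    ∃ B, ∀ s ∈ Icc a b, |logRenewalError s| ≤ B := by
  refine ⟨logRenewal b + (Real.exp 1 - 1) * (|a| + |b| + (Real.exp 1 - 2) / 2), fun s hs => ?_⟩
  have he := exp_one_sub_one_pos
  have h2 : 0 ≤ Real.exp 1 - 2 := by linarith [Real.add_one_le_exp 1]
  have hs' : |s + (Real.exp 1 - 2) / 2| ≤ |a| + |b| + (Real.exp 1 - 2) / 2 := by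
    rw [abs_le]
    constructor <;> linarith [hs.1, hs.2, neg_abs_le a, le_abs_self b, abs_nonneg a, abs_nonneg b]
  calc |logRenewalError s|
      ≤ |logRenewal s| + |(Real.exp 1 - 1) * (s + (Real.exp 1 - 2) / 2)| := abs_sub _ _
    _ ≤ _ := by
      rw [abs_of_nonneg (logRenewal_nonneg s), abs_mul, abs_of_pos he]
      exact add_le_add (monotone_logRenewal hs.2) (mul_le_mul_of_nonneg_left hs' he.le)

/-- Contraction of the error over consecutive unit intervals. -/
lemma abs_logRenewalError_le_on_next {a B : ℝ} (ha : 0 ≤ a)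
    (hB : ∀ s ∈ Icc (a - 1) a, |logRenewalError s| ≤ B) :
    ∀ s ∈ Icc a (a + 1), |logRenewalError s| ≤ B * ∫ y in (0 : ℝ)..1, reducedKernel y := by
  set r := ∫ y in (0 : ℝ)..1, reducedKernel y with hr
  have hr0 : 0 ≤ r := integral_reducedKernel_nonneg
  have hr1 : r < 1 := integral_reducedKernel_lt_one
  have hB0 : 0 ≤ B := (abs_nonneg _).trans (hB a ⟨by linarith, le_rfl⟩)
  set S := (fun s => |logRenewalError s|) '' Icc a (a + 1)
  obtain ⟨B', hB'⟩ := exists_abs_logRenewalError_le a (a + 1)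
  have hbdd : BddAbove S := ⟨B', by rintro _ ⟨s, hs, rfl⟩; exact hB' s hs⟩
  have hne : S.Nonempty := ⟨_, a, ⟨le_rfl, by linarith⟩, rfl⟩
  -- The window `[s - 1, s]` meets both `[a - 1, a]` and `[a, a + 1]`, so the supremum being
  -- estimated also occurs on the right.
  have hle : ∀ s ∈ Icc a (a + 1), |logRenewalError s| ≤ max B (sSup S) * r := fun s hs => by
    refine abs_logRenewalError_le (ha.trans hs.1) fun x hx => ?_
    rcases le_total x a with hxa | hxa
    · exact (hB x ⟨by linarith [hx.1, hs.1], hxa⟩).trans (le_max_left _ _)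
    · exact (le_csSup hbdd ⟨x, ⟨hxa, hx.2.trans hs.2⟩, rfl⟩).trans (le_max_right _ _)
  have hsup : sSup S ≤ max B (sSup S) * r :=
    csSup_le hne (by rintro _ ⟨s, hs, rfl⟩; exact hle s hs)
  -- If the supremum exceeded `B ≥ 0`, it would be positive and at most `r < 1` times itself.
  have hSB : sSup S ≤ B := by
    by_contra! hlt
    rw [max_eq_right hlt.le] at hsup
    nlinarith
  rwa [max_eq_left hSB] at hle

lemma tendsto_logRenewalError : Tendsto logRenewalError atTop (nhds 0) := by
  set r := ∫ y in (0 : ℝ)..1, reducedKernel y with hr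
  have hr0 : 0 ≤ r := integral_reducedKernel_nonneg
  obtain ⟨B, hB⟩ := exists_abs_logRenewalError_le 0 1
  have hstep : ∀ n : ℕ, ∀ s ∈ Icc (n : ℝ) (n + 1), |logRenewalError s| ≤ B * r ^ n := by
    intro n
    induction n with
    | zero => simpa using hB
    | succ n ih =>
      have := abs_logRenewalError_le_on_next (a := (n : ℝ) + 1) (by positivity)
        (by simpa using ih)
      rw [pow_succ, ← mul_assoc]
      simpa using this
  have hlim : Tendsto (fun t : ℝ => B * r ^ ⌊t⌋₊) atTop (nhds 0) := by
    have := ((tendsto_pow_atTop_nhds_zero_of_lt_one hr0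
      integral_reducedKernel_lt_one).comp (tendsto_nat_floor_atTop (α := ℝ))).const_mul B
    simpa using this
  refine squeeze_zero_norm' ?_ hlim
  filter_upwards [eventually_ge_atTop 0] with t ht
  exact hstep _ t ⟨Nat.floor_le ht, (Nat.lt_floor_add_one t).le⟩

/-! ### The constants `μ_f` and `c_f` -/

lemma integral_logStep_of_isUniform {Ω : Type*} [MeasurableSpace Ω] {P : Measure Ω} {V : Ω → ℝ}
    (hV : Measurable V) (hVs : pdf.IsUniform V (Icc 0 1) P volume) :
    ∫ ω, logStep (V ω) ∂P = 1 / (Real.exp 1 - 1) := by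
  have he := exp_one_sub_one_pos
  rw [← integral_map (f := fun y => y) (φ := fun ω => logStep (V ω))
    (measurable_logStep.comp hV).aemeasurable (by fun_prop),
    map_logStep_eq_logUniform hV hVs, logUniform,
    integral_withDensity_eq_integral_toReal_smul (by fun_prop)
      (Eventually.of_forall fun _ => ENNReal.ofReal_lt_top),
    integral_Icc_eq_integral_Ioc, ← intervalIntegral.integral_of_le zero_le_one]
  have : ∀ y : ℝ, (ENNReal.ofReal (Real.exp y / (Real.exp 1 - 1))).toReal • y
      = Real.exp y / (Real.exp 1 - 1) * y := fun y => by
    rw [ENNReal.toReal_ofReal (by positivity), smul_eq_mul]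
  simp only [this]
  rw [intervalIntegral.integral_eq_sub_of_hasDerivAt
    (f := fun y => (y - 1) * Real.exp y / (Real.exp 1 - 1))]
  · simp
    ring
  · intro y _
    refine ((((hasDerivAt_id y).sub_const 1).mul (Real.hasDerivAt_exp y)).div_const
      (Real.exp 1 - 1)).congr_deriv ?_
    simp only [id]
    ring
  · exact Continuous.intervalIntegrable (by fun_prop) _ _

lemma invFunOn_logStep {u : ℝ} (hu : u ∈ Icc (0 : ℝ) 1) :
    Function.invFunOn logStep (Icc 0 1) u = expStep u := by
  have h := bijOn_logStep.invOn_invFunOn.2 hu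
  have hmem := bijOn_logStep.surjOn.mapsTo_invFunOn hu
  exact strictMonoOn_logStep.injOn hmem (expStep_mem hu) (h.trans (logStep_expStep u).symm)

lemma integral_logStep_sub {u : ℝ} (hu : u ∈ Icc (0 : ℝ) 1) :
    ∫ x in (expStep u)..1, (logStep x - u)
      = (Real.exp u - Real.exp 1 * u) / (Real.exp 1 - 1) := by
  have he := exp_one_sub_one_pos
  have hle := (expStep_mem hu).2
  have hpos : ∀ x ∈ uIcc (expStep u) 1, 0 < 1 + (Real.exp 1 - 1) * x := fun x hx => by
    rw [uIcc_of_le hle] at hx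
    have := mul_nonneg he.le ((expStep_mem hu).1.trans hx.1)
    linarith
  rw [intervalIntegral.integral_eq_sub_of_hasDerivAt
    -- The antiderivative `w log w - w` in `w = 1 + (e-1)x`; at `x = expStep u` one has `w = e^u`.
    (f := fun x => ((1 + (Real.exp 1 - 1) * x) * Real.log (1 + (Real.exp 1 - 1) * x)
      - (1 + (Real.exp 1 - 1) * x)) / (Real.exp 1 - 1) - u * x)]
  · have h1 : 1 + (Real.exp 1 - 1) * expStep u = Real.exp u := by
      rw [expStep, mul_div_cancel₀ _ he.ne']; ring
    rw [h1, mul_one, add_sub_cancel, Real.log_exp, Real.log_exp, expStep]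
    field_simp
    ring
  · intro x hx
    have hx' := (hpos x hx).ne'
    have hd : HasDerivAt (fun x => 1 + (Real.exp 1 - 1) * x) (Real.exp 1 - 1) x := by
      simpa using ((hasDerivAt_id x).const_mul (Real.exp 1 - 1)).const_add 1
    refine ((((hd.mul (hd.log hx')).sub hd).div_const (Real.exp 1 - 1)).sub
      ((hasDerivAt_id x).const_mul u)).congr_deriv ?_
    rw [logStep]
    field_simp
    ring
  · refine ContinuousOn.intervalIntegrable ?_
    refine ContinuousOn.sub (ContinuousOn.log (by fun_prop) fun x hx => (hpos x hx).ne') ?_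
    exact continuousOn_const

lemma excessConst_logStep {Ω : Type*} [MeasurableSpace Ω] {P : Measure Ω} {U : ℕ → Ω → ℝ}
    (hU : Measurable (U 0)) (hU0 : pdf.IsUniform (U 0) (Icc 0 1) P volume) :
    excessConst P U logStep = (Real.exp 1 - 2) / 2 := by
  have he := exp_one_sub_one_pos
  have h : ∀ u ∈ uIcc (0 : ℝ) 1,
      ∫ x in (Function.invFunOn logStep (Icc 0 1) u)..1, (logStep x - u)
        = (Real.exp u - Real.exp 1 * u) / (Real.exp 1 - 1) := fun u hu => by
    rw [uIcc_of_le zero_le_one] at hu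
    rw [invFunOn_logStep hu, integral_logStep_sub hu]
  rw [excessConst, stepMean, integral_logStep_of_isUniform hU hU0, intervalIntegral.integral_congr h,
    intervalIntegral.integral_div, intervalIntegral.integral_sub
      (Continuous.intervalIntegrable (by fun_prop) _ _)
      (Continuous.intervalIntegrable (by fun_prop) _ _),
    intervalIntegral.integral_const_mul, integral_exp, integral_id, Real.exp_zero]
  field_simp
  ring

/-! ### Assembly -/

theorem mainTheorem2
    {Ω Ω' : Type*} [MeasurableSpace Ω] [MeasurableSpace Ω']
    (P : Measure Ω) [IsProbabilityMeasure P] (P' : Measure Ω') [IsProbabilityMeasure P']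
    -- independent numbers drawn uniformly from `[1, e]`
    (X : ℕ → Ω → ℝ) (hX_meas : ∀ i, Measurable (X i)) (hX_indep : iIndepFun X P)
    (hX_unif : ∀ i, pdf.IsUniform (X i) (Icc 1 (Real.exp 1)) P volume)
    -- independent numbers drawn uniformly from `[0, 1]`
    (U : ℕ → Ω' → ℝ) (hU_meas : ∀ i, Measurable (U i)) (hU_indep : iIndepFun U P')
    (hU_unif : ∀ i, pdf.IsUniform (U i) (Icc 0 1) P' volume) :
    -- `N(t)` is finite and `N(t) = (e - 1) (t + (e - 2) / 2) + o(1)`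
    ((∀ t : ℝ, 0 ≤ t → expectedProductDraws P X t ≠ ∞) ∧
      (fun t : ℝ => (expectedProductDraws P X t).toReal
          - (Real.exp 1 - 1) * (t + (Real.exp 1 - 2) / 2))
        =o[atTop] (fun _ : ℝ => (1 : ℝ))) ∧
    -- this is the case `f(x) = ln (1 + (e - 1) x)` of `N_f(t) = (t + c_f) / μ_f + o(1)`
    (StrictMonoOn logStep (Icc 0 1) ∧ BijOn logStep (Icc 0 1) (Icc 0 1) ∧
      (∀ t : ℝ, 0 ≤ t → expectedSumDraws P' U logStep t = expectedProductDraws P X t) ∧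
      (∀ i, ∫ ω, logStep (U i ω) ∂P' = stepMean P' U logStep) ∧
      stepMean P' U logStep = 1 / (Real.exp 1 - 1) ∧
      excessConst P' U logStep = (Real.exp 1 - 2) / 2 ∧
      (fun t : ℝ => (expectedSumDraws P' U logStep t).toReal
          - (t + excessConst P' U logStep) / stepMean P' U logStep)
        =o[atTop] (fun _ : ℝ => (1 : ℝ))) := by
  have hN : ∀ t, expectedProductDraws P X t = renewal logUniform t := fun t => by
    have hmem := fun i => ae_mem_of_isUniform (hX_meas i) measurableSet_Icc (hX_unif i)
    rw [expectedProductDraws_eq_expectedSumDraws fun i =>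
      (hmem i).mono fun ω hω => zero_lt_one.trans_le hω.1]
    exact expectedSumDraws_eq_renewal hX_meas hX_indep Real.measurable_log
      (fun i => (hmem i).mono fun ω hω => Real.log_nonneg hω.1)
      (fun i => map_log_eq_logUniform (hX_meas i) (hX_unif i)) t
  have hNf : ∀ t, expectedSumDraws P' U logStep t = renewal logUniform t :=
    expectedSumDraws_eq_renewal hU_meas hU_indep measurable_logStep
      (fun i => (ae_mem_of_isUniform (hU_meas i) measurableSet_Icc (hU_unif i)).mono
        fun ω hω => (logStep_mem hω).1)
      (fun i => map_logStep_eq_logUniform (hU_meas i) (hU_unif i))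
  have hmean : stepMean P' U logStep = 1 / (Real.exp 1 - 1) :=
    integral_logStep_of_isUniform (hU_meas 0) (hU_unif 0)
  have hexc := excessConst_logStep (hU_meas 0) (hU_unif 0)
  have hlim : (fun t : ℝ => (renewal logUniform t).toReal
      - (Real.exp 1 - 1) * (t + (Real.exp 1 - 2) / 2)) =o[atTop] (fun _ : ℝ => (1 : ℝ)) :=
    (isLittleO_one_iff ℝ).mpr tendsto_logRenewalError
  refine ⟨⟨fun t _ => hN t ▸ renewal_logUniform_ne_top t, ?_⟩, strictMonoOn_logStep,
    bijOn_logStep, fun t _ => (hNf t).trans (hN t).symm,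
    fun i => (integral_logStep_of_isUniform (hU_meas i) (hU_unif i)).trans hmean.symm,
    hmean, hexc, ?_⟩
  · simpa only [hN] using hlim
  · simpa only [hNf, hmean, hexc, div_div_eq_mul_div, div_one, mul_comm] using hlim
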